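/- Let $X$ be a set, $m:X\to\mathbb R$ a function and $K:X\times X\to\mathbb R$ a positive (semi)definite kernel, and let $P=\mathcal{GP}(m,K)$ be the law on $\mathbb R^X$ (with the product $\sigma$-algebra) of the Gaussian process with mean function $m$ and covariance kernel $K$. Let $N\ge 0$, $x_1,\dots,x_N\in X$, $y\in\mathbb R^N$ and $\sigma_n>0$. Write $f_N=(f(x_1),\dots,f(x_N))$, $m_N=(m(x_1),\dots,m(x_N))$, $K_{NN}=(K(x_i,x_j))_{i,j=1}^N$, $k_N(t)=(K(t,x_1),\dots,K(t,x_N))$, and let $$Q=\mathcal{GP}\Big(m(t)+k_N(t)(K_{NN}+\sigma_n^2 I)^{-1}(y-m_N),\ \ K(s,t)-k_N(s)(K_{NN}+\sigma_n^2 I)^{-1}k_N(t)^T\Big)$$ be the law on $\mathbb R^X$ of the regression posterior with noise variance $\sigma_n^2$. Denote by $P(f_N),Q(f_N)$ the laws of $f_N$ under $P,Q$. ($K_{NN}$ need not be invertible.) Then a regular conditional distribution $P(f\mid f_N)$ of $f$ given $f_N$ under $P$ exists, and $Q(f\mid f_N)=P(f\mid f_N)$, in the sense that a Markov kernel from $\mathbb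 R^N$ to $\mathbb R^X$ is a regular conditional distribution of $f$ given $f_N$ under $Q$ if and only if it is one under $P$. Moreover, for all such conditional distributions, $$KL(Q\|P)=KL\big(Q(f_N)Q(f\mid f_N)\,\big\|\,P(f_N)P(f\mid f_N)\big)=KL\big(Q(f_N)\|P(f_N)\big),$$ where the products denote the joint laws on $\mathbb R^N\times\mathbb R^X$. This divergence is finite and equals $$\tfrac12\ln\det\big[K_{NN}+\sigma_n^2 I\big]-\tfrac N2\ln\sigma_n^2-\tfrac12\,\mathrm{tr}\big[K_{NN}(K_{NN}+\sigma_n^2 I)^{-1}\big]+\tfrac12\,(y-m_N)^T(K_{NN}+\sigma_n^2 I)^{-1}K_{NN}(K_{NN}+\sigma_n^2 I)^{-1}(y-m_N).$$ -/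

import Mathlib

open MeasureTheory ProbabilityTheory InformationTheory
open scoped Matrix ENNReal

noncomputable section

namespace GPRegression

/-- The law `P` on the space of functions `X → ℝ` (with the product σ-algebra) is the Gaussian
process `GP(m, K)`: the coordinate process is Gaussian, with mean function `m` and covariance
kernel `K`. (Such a `K` is automatically symmetric and positive semidefinite, and `P` is
automatically a probability measure.) -/
structure IsGP {X : Type*} (m : X → ℝ) (K : X → X → ℝ) (P : Measure (X → ℝ)) : Prop where
  isGaussianProcess : IsGaussianProcess (fun (t : X) (f : X → ℝ) ↦ f t) P
  mean_eq : ∀ t, ∫ f, f t ∂P = m t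
  cov_eq : ∀ s t, cov[fun f : X → ℝ ↦ f s, fun f : X → ℝ ↦ f t; P] = K s t

/-- The vector `f_N = (f(x₁), …, f(x_N))` of values of `f` at the training inputs. -/
def evalAt {X : Type*} {N : ℕ} (x : Fin N → X) (f : X → ℝ) : Fin N → ℝ := fun i ↦ f (x i)

/-- The kernel matrix `K_NN = (K(xᵢ, xⱼ))ᵢⱼ`. -/
def gram {X : Type*} {N : ℕ} (K : X → X → ℝ) (x : Fin N → X) : Matrix (Fin N) (Fin N) ℝ :=
  Matrix.of fun i j ↦ K (x i) (x j)

/-- The regularized kernel matrix `K_NN + σ² I`. -/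
def noisyGram {X : Type*} {N : ℕ} (K : X → X → ℝ) (x : Fin N → X) (σ : ℝ) :
    Matrix (Fin N) (Fin N) ℝ :=
  gram K x + σ ^ 2 • (1 : Matrix (Fin N) (Fin N) ℝ)

/-- The vector `k_N(t) = (K(t, x₁), …, K(t, x_N))`. -/
def kVec {X : Type*} {N : ℕ} (K : X → X → ℝ) (x : Fin N → X) (t : X) : Fin N → ℝ :=
  fun i ↦ K t (x i)

/-- The posterior mean `t ↦ m(t) + k_N(t) (K_NN + σ² I)⁻¹ (y - m_N)`. -/
def posteriorMean {X : Type*} {N : ℕ} (m : X → ℝ) (K : X → X → ℝ) (x : Fin N → X)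
    (y : Fin N → ℝ) (σ : ℝ) (t : X) : ℝ :=
  m t + kVec K x t ⬝ᵥ ((noisyGram K x σ)⁻¹ *ᵥ (y - evalAt x m))

/-- The posterior kernel `(s, t) ↦ K(s, t) - k_N(s) (K_NN + σ² I)⁻¹ k_N(t)ᵀ`. -/
def posteriorKernel {X : Type*} {N : ℕ} (K : X → X → ℝ) (x : Fin N → X) (σ : ℝ)
    (s t : X) : ℝ :=
  K s t - kVec K x s ⬝ᵥ ((noisyGram K x σ)⁻¹ *ᵥ kVec K x t)

/-- The Markov kernel `κ` is a (regular) conditional distribution `P(f | f_N)` of the whole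
function `f` given `f_N` under `P`: it disintegrates the joint law of `(f_N, f)`. -/
structure IsCondLaw {X : Type*} {N : ℕ} (x : Fin N → X) (P : Measure (X → ℝ))
    (κ : Kernel (Fin N → ℝ) (X → ℝ)) : Prop where
  isMarkovKernel : IsMarkovKernel κ
  compProd_eq : P.map (evalAt x) ⊗ₘ κ = P.map (fun f ↦ (evalAt x f, f))

end GPRegression

end

/-! Each vector `k_N(t)` lies in the range of `K_NN`, even when `K_NN` is singular
(`IsGP.exists_kVec_eq`), so `k_N(t) = K_NN A(t)` for some coefficients `A(t)`. The residual `f(t) -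
A(t)·f_N` is then uncorrelated with `f_N`, hence independent of it by Gaussianity. The posterior
update preserves the relation with the same `A`, and leaves the mean and covariance of the residual
unchanged. So `P` and `Q` share one conditional law: add `A(t)·f_N` to an independent residual
(`exists_isCondLaw_both`).

Adjoining `f_N` to `f` does not change the divergence, and a common conditional law drops out of it,
which leaves the divergence of the laws of `f_N`. An orthogonal diagonalization of `K_NN` turns
these into products of one-dimensional Gaussians (`IsGP.map_coordinates`). Each factor is explicit
(`exists_logDensity_posterior`), and the sum is the closed formula (`klDiv_map_evalAt_posterior`).
The densities are exponentials, so the two laws of `f_N` are equivalent; this is what makes the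
conditional laws under `P` and under `Q` the same kernels. -/

noncomputable section

namespace GPRegression

/-! ### Kullback-Leibler divergence and composition products -/

section Divergence

variable {α β : Type*} [MeasurableSpace α] [MeasurableSpace β]

/-- The Kullback-Leibler divergence is invariant under a measurable map with a measurable left
inverse. -/
lemma klDiv_map_of_leftInverse (μ ν : Measure α) [IsFiniteMeasure μ] [IsFiniteMeasure ν]
    {g : α → β} {h : β → α} (hg : Measurable g) (hh : Measurable h)
    (hhg : Function.LeftInverse h g) : klDiv (μ.map g) (ν.map g) = klDiv μ ν := by
  refine le_antisymm (klDiv_map_le μ ν hg) ?_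
  have key := klDiv_map_le (μ.map g) (ν.map g) hh
  rwa [Measure.map_map hh hg, Measure.map_map hh hg, hhg.comp_eq_id, Measure.map_id,
    Measure.map_id] at key

lemma klDiv_withDensity_exp {μ ν : Measure α} [IsProbabilityMeasure μ] [IsProbabilityMeasure ν]
    {g : α → ℝ} (hg : Measurable g) (hμ : μ = ν.withDensity fun x ↦ ENNReal.ofReal (Real.exp (g x)))
    (hint : Integrable g μ) :
    klDiv μ ν ≠ ∞ ∧ (klDiv μ ν).toReal = ∫ x, g x ∂μ := by
  have hac : μ ≪ ν := hμ ▸ withDensity_absolutelyContinuous _ _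
  have hm : Measurable fun x ↦ ENNReal.ofReal (Real.exp (g x)) := by fun_prop
  have hllr : llr μ ν =ᵐ[μ] g := by
    refine hac.ae_le ?_
    have hrn : μ.rnDeriv ν =ᵐ[ν] fun x ↦ ENNReal.ofReal (Real.exp (g x)) := by
      conv_lhs => rw [hμ]
      exact Measure.rnDeriv_withDensity ν hm
    filter_upwards [hrn] with x hx
    simp [llr, hx, ENNReal.toReal_ofReal (Real.exp_nonneg _)]
  refine ⟨klDiv_ne_top hac ((integrable_congr hllr).2 hint), ?_⟩
  rw [toReal_klDiv_of_measure_eq hac (by simp), integral_congr_ae hllr]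

/-- The density of `μ ⊗ₘ κ` with respect to `ν ⊗ₘ κ` depends on the first coordinate only, so it is
the same function for `κ` and `η`. Working with joint laws avoids almost everywhere uniqueness of
kernels, which would need a countability assumption on `β`; for `X → ℝ` with `X` uncountable there
is none. -/
lemma compProd_eq_of_absolutelyContinuous {μ ν : Measure α} [IsFiniteMeasure μ]
    [IsFiniteMeasure ν] (hμν : μ ≪ ν) {κ η : Kernel α β} [IsMarkovKernel κ] [IsMarkovKernel η]
    (h : ν ⊗ₘ κ = ν ⊗ₘ η) : μ ⊗ₘ κ = μ ⊗ₘ η := by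
  have key (κ : Kernel α β) [IsMarkovKernel κ] :
      μ ⊗ₘ κ = (ν ⊗ₘ κ).withDensity fun p ↦ μ.rnDeriv ν p.1 := by
    ext s hs
    have hr := Measure.measurable_rnDeriv μ ν
    have hr' : Measurable fun p : α × β ↦ μ.rnDeriv ν p.1 := hr.comp measurable_fst
    conv_lhs => rw [← Measure.withDensity_rnDeriv_eq μ ν hμν]
    rw [Measure.compProd_apply hs, withDensity_apply _ hs, ← lintegral_indicator hs,
      Measure.lintegral_compProd (hr'.indicator hs),
      lintegral_withDensity_eq_lintegral_mul _ hr (Kernel.measurable_kernel_prodMk_left hs)]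
    refine lintegral_congr fun a ↦ ?_
    have hind (b : β) : s.indicator (fun p : α × β ↦ μ.rnDeriv ν p.1) (a, b)
        = (Prod.mk a ⁻¹' s).indicator (fun _ ↦ μ.rnDeriv ν a) b := by
      rfl
    simp only [hind, Pi.mul_apply]
    rw [lintegral_indicator_const (measurable_prodMk_left hs)]
  rw [key κ, key η, h]

end Divergence

/-! ### Densities and divergences of finite products -/

section Product

variable {ι : Type*} [Fintype ι] {α : ι → Type*} [∀ i, MeasurableSpace (α i)]

lemma lintegral_pi_prod (ν : ∀ i, Measure (α i)) [∀ i, IsProbabilityMeasure (ν i)]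
    {f : ∀ i, α i → ℝ≥0∞} (hf : ∀ i, Measurable (f i)) :
    ∫⁻ x, ∏ i, f i (x i) ∂Measure.pi ν = ∏ i, ∫⁻ x, f i x ∂ν i := by
  refine (lintegral_prod_eq_prod_lintegral_of_indepFun Finset.univ
    (fun i (x : ∀ i, α i) ↦ f i (x i)) (iIndepFun_pi fun i ↦ (hf i).aemeasurable)
    fun i ↦ (hf i).comp (measurable_pi_apply i)).trans ?_
  exact Finset.prod_congr rfl fun i _ ↦ (measurePreserving_eval ν i).lintegral_comp (hf i)

lemma pi_withDensity (ν : ∀ i, Measure (α i)) [∀ i, IsProbabilityMeasure (ν i)]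
    {f : ∀ i, α i → ℝ≥0∞} (hf : ∀ i, Measurable (f i))
    [∀ i, SigmaFinite ((ν i).withDensity (f i))] :
    Measure.pi (fun i ↦ (ν i).withDensity (f i))
      = (Measure.pi ν).withDensity fun x ↦ ∏ i, f i (x i) := by
  refine Measure.pi_eq fun s hs ↦ ?_
  have hS : MeasurableSet (Set.univ.pi s) := MeasurableSet.univ_pi hs
  have hind (x : ∀ i, α i) : (Set.univ.pi s).indicator (fun x ↦ ∏ i, f i (x i)) x
      = ∏ i, (s i).indicator (f i) (x i) := by
    classical
    by_cases hx : x ∈ Set.univ.pi s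
    · rw [Set.indicator_of_mem hx]
      exact Finset.prod_congr rfl fun i _ ↦
        (Set.indicator_of_mem (hx i (Set.mem_univ i)) _).symm
    · rw [Set.indicator_of_notMem hx]
      simp only [Set.mem_univ_pi, not_forall] at hx
      obtain ⟨i, hi⟩ := hx
      exact (Finset.prod_eq_zero (Finset.mem_univ i) (Set.indicator_of_notMem hi _)).symm
  rw [withDensity_apply _ hS, ← lintegral_indicator hS]
  simp only [hind]
  rw [lintegral_pi_prod ν fun i ↦ (hf i).indicator (hs i)]
  exact Finset.prod_congr rfl fun i _ ↦ by
    rw [lintegral_indicator (hs i), withDensity_apply _ (hs i)]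

/-- The log-densities add up over the coordinates. Writing densities as exponentials makes them
nowhere zero, which gives absolute continuity in both directions. -/
lemma klDiv_pi_withDensity_exp {μ ν : ∀ i, Measure (α i)} [∀ i, IsProbabilityMeasure (μ i)]
    [∀ i, IsProbabilityMeasure (ν i)] {g : ∀ i, α i → ℝ} (hg : ∀ i, Measurable (g i))
    (hμ : ∀ i, μ i = (ν i).withDensity fun x ↦ ENNReal.ofReal (Real.exp (g i x)))
    (hint : ∀ i, Integrable (g i) (μ i)) :
    Measure.pi μ ≪ Measure.pi ν ∧ Measure.pi ν ≪ Measure.pi μ ∧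
      klDiv (Measure.pi μ) (Measure.pi ν) ≠ ∞ ∧
      (klDiv (Measure.pi μ) (Measure.pi ν)).toReal = ∑ i, ∫ x, g i x ∂μ i := by
  have hsf (i : ι) : SigmaFinite ((ν i).withDensity fun x ↦ ENNReal.ofReal (Real.exp (g i x))) :=
    hμ i ▸ inferInstance
  have hG : Measurable fun x : ∀ i, α i ↦ ∑ i, g i (x i) := by fun_prop
  have hpi : Measure.pi μ
      = (Measure.pi ν).withDensity fun x ↦ ENNReal.ofReal (Real.exp (∑ i, g i (x i))) := by
    have h1 : Measure.pi μ
        = Measure.pi fun i ↦ (ν i).withDensity fun x ↦ ENNReal.ofReal (Real.exp (g i x)) := by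
      congr 1
      exact funext hμ
    rw [h1, pi_withDensity ν fun i ↦ by fun_prop]
    congr 1
    ext x
    rw [Real.exp_sum, ENNReal.ofReal_prod_of_nonneg fun _ _ ↦ (Real.exp_nonneg _)]
  have hcomp (i : ι) : Integrable (fun x : ∀ i, α i ↦ g i (x i)) (Measure.pi μ) :=
    (measurePreserving_eval μ i).integrable_comp_of_integrable (hint i)
  obtain ⟨htop, hkl⟩ := klDiv_withDensity_exp hG hpi (integrable_finsetSum _ fun i _ ↦ hcomp i)
  refine ⟨hpi ▸ withDensity_absolutelyContinuous _ _, ?_, htop, ?_⟩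
  · rw [hpi]
    exact withDensity_absolutelyContinuous' hG.exp.ennreal_ofReal.aemeasurable
      (ae_of_all _ fun x ↦ by simp [Real.exp_pos])
  · rw [hkl, integral_finsetSum _ fun i _ ↦ hcomp i]
    exact Finset.sum_congr rfl fun i _ ↦ by
      rw [← (measurePreserving_eval μ i).map_eq, integral_map (measurable_pi_apply i).aemeasurable (hg i).aestronglyMeasurable]

end Product

/-! ### One-dimensional Gaussian laws -/

section Gaussian

/-- The logarithm of the density of `gaussianReal a w` with respect to `gaussianReal b v`. -/
def gaussianLogDensity (a : ℝ) (w : NNReal) (b : ℝ) (v : NNReal) (x : ℝ) : ℝ :=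
  1 / 2 * Real.log (v / w) + (x - b) ^ 2 / (2 * v) - (x - a) ^ 2 / (2 * w)

lemma measurable_gaussianLogDensity (a : ℝ) (w : NNReal) (b : ℝ) (v : NNReal) :
    Measurable (gaussianLogDensity a w b v) := by
  unfold gaussianLogDensity; fun_prop

lemma gaussianReal_eq_withDensity_gaussianReal (a b : ℝ) {w v : NNReal} (hw : w ≠ 0)
    (hv : v ≠ 0) :
    gaussianReal a w = (gaussianReal b v).withDensity
      fun x ↦ ENNReal.ofReal (Real.exp (gaussianLogDensity a w b v x)) := by
  have hm := measurable_gaussianLogDensity a w b v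
  rw [gaussianReal_of_var_ne_zero _ hw, gaussianReal_of_var_ne_zero _ hv,
    ← withDensity_mul _ (measurable_gaussianPDF _ _) (by fun_prop)]
  congr 1
  ext x
  have hw' : (0 : ℝ) < w := by positivity
  have hv' : (0 : ℝ) < v := by positivity
  rw [Pi.mul_apply, gaussianPDF, gaussianPDF,
    ← ENNReal.ofReal_mul (gaussianPDFReal_nonneg _ _ _)]
  congr 1
  have hlog : Real.exp (1 / 2 * Real.log (v / w)) = √v / √w := by
    rw [← Real.sqrt_div hv'.le, Real.sqrt_eq_rpow, Real.rpow_def_of_pos (by positivity), mul_comm]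
  have hsw : √(w : ℝ) ≠ 0 := by positivity
  have hsv : √(v : ℝ) ≠ 0 := by positivity
  have hpi : √(2 * Real.pi) ≠ 0 := by positivity
  rw [gaussianPDFReal, gaussianPDFReal, gaussianLogDensity, Real.exp_sub, Real.exp_add, hlog,
    Real.sqrt_mul (x := 2 * Real.pi) (by positivity) w,
    Real.sqrt_mul (x := 2 * Real.pi) (by positivity) v, neg_div, neg_div, Real.exp_neg,
    Real.exp_neg]
  have := Real.exp_pos ((x - b) ^ 2 / (2 * v))
  have := Real.exp_pos ((x - a) ^ 2 / (2 * w))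
  field_simp

lemma integral_sub_sq_gaussianReal (a b : ℝ) (w : NNReal) :
    Integrable (fun x ↦ (x - b) ^ 2) (gaussianReal a w) ∧
      ∫ x, (x - b) ^ 2 ∂gaussianReal a w = w + (a - b) ^ 2 := by
  have hL : MemLp id 2 (gaussianReal a w) := memLp_id_gaussianReal' 2 (by simp)
  have hL' : MemLp (fun x : ℝ ↦ x - b) 2 (gaussianReal a w) := hL.sub (memLp_const b)
  have h1 : Integrable (fun x : ℝ ↦ x) (gaussianReal a w) := hL.integrable (by simp)
  refine ⟨hL'.integrable_sq, ?_⟩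
  have hvar := variance_eq_sub hL'
  rw [variance_sub_const (by fun_prop), variance_fun_id_gaussianReal,
    integral_sub h1 (integrable_const b), integral_id_gaussianReal] at hvar
  simp at hvar
  linarith

lemma integral_gaussianLogDensity (a b : ℝ) {w : NNReal} (v : NNReal) (hw : w ≠ 0) :
    Integrable (gaussianLogDensity a w b v) (gaussianReal a w) ∧
      ∫ x, gaussianLogDensity a w b v x ∂gaussianReal a w
        = 1 / 2 * Real.log (v / w) + (w + (a - b) ^ 2) / (2 * v) - 1 / 2 := by
  obtain ⟨hb, hb'⟩ := integral_sub_sq_gaussianReal a b w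
  obtain ⟨ha, ha'⟩ := integral_sub_sq_gaussianReal a a w
  have h1 : Integrable (fun x ↦ 1 / 2 * Real.log (v / w) + (x - b) ^ 2 / (2 * (v : ℝ)))
      (gaussianReal a w) := (integrable_const _).add (hb.div_const _)
  refine ⟨h1.sub (ha.div_const _), ?_⟩
  unfold gaussianLogDensity
  rw [integral_sub h1 (ha.div_const _), integral_add (integrable_const _) (hb.div_const _),
    integral_div, integral_div, hb', ha']
  have hw' : (w : ℝ) ≠ 0 := by exact_mod_cast hw
  simp
  field_simp

/-- The density of the posterior of one Gaussian coordinate with prior variance `d`, noise variance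
`r` and observation `z` with respect to its prior; for `d = 0` both are the Dirac mass at `0`. -/
lemma exists_logDensity_posterior {d r : ℝ} (hd : 0 ≤ d) (hr : 0 < r) (z : ℝ) :
    ∃ g : ℝ → ℝ, Measurable g ∧
      gaussianReal (d * z / (d + r)) (d * r / (d + r)).toNNReal
        = (gaussianReal 0 d.toNNReal).withDensity (fun x ↦ ENNReal.ofReal (Real.exp (g x))) ∧
      Integrable g (gaussianReal (d * z / (d + r)) (d * r / (d + r)).toNNReal) ∧
      ∫ x, g x ∂gaussianReal (d * z / (d + r)) (d * r / (d + r)).toNNReal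
        = 1 / 2 * Real.log (d + r) - 1 / 2 * Real.log r - 1 / 2 * (d / (d + r))
          + 1 / 2 * (d * z ^ 2 / (d + r) ^ 2) := by
  rcases hd.eq_or_lt with rfl | hd
  · refine ⟨0, measurable_zero, ?_⟩
    simp
  have hw : (0 : ℝ) < d * r / (d + r) := by positivity
  have hw' : (d * r / (d + r)).toNNReal ≠ 0 := by simpa using hw
  refine ⟨gaussianLogDensity _ _ 0 _, measurable_gaussianLogDensity _ _ _ _,
    gaussianReal_eq_withDensity_gaussianReal _ _ hw' (by simpa using hd),
    (integral_gaussianLogDensity _ _ _ hw').1, ?_⟩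
  rw [(integral_gaussianLogDensity _ _ _ hw').2, Real.coe_toNNReal _ hd.le,
    Real.coe_toNNReal _ hw.le]
  have : d / (d * r / (d + r)) = (d + r) / r := by field_simp
  rw [this, Real.log_div (by positivity) hr.ne']
  field_simp
  ring

end Gaussian

/-! ### Gaussian processes: determination by moments, independence -/

section GaussianProcess

variable {T Ω Ω' : Type*} [MeasurableSpace Ω] [MeasurableSpace Ω']

lemma variance_sum_const_mul {ι : Type*} [Fintype ι] {P : Measure Ω} [IsFiniteMeasure P]
    {Z : ι → Ω → ℝ} (c : ι → ℝ) (hZ : ∀ i, MemLp (Z i) 2 P) :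
    Var[fun ω ↦ ∑ i, c i * Z i ω; P] = ∑ i, ∑ j, c j * (c i * cov[Z i, Z j; P]) := by
  have hc (i : ι) : MemLp (fun ω ↦ c i * Z i ω) 2 P := (hZ i).const_mul (c i)
  rw [← covariance_self (memLp_finsetSum _ fun i _ ↦ hc i).aemeasurable,
    covariance_fun_sum_fun_sum hc hc]
  simp only [covariance_const_mul_left, covariance_const_mul_right]

/-- The law of a real Gaussian process is determined by its mean and its covariance. -/
lemma map_eq_of_isGaussianProcess {P : Measure Ω} {P' : Measure Ω'} {Y : T → Ω → ℝ}
    {Y' : T → Ω' → ℝ} (hY : IsGaussianProcess Y P) (hY' : IsGaussianProcess Y' P')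
    (mY : Measurable fun ω t ↦ Y t ω) (mY' : Measurable fun ω t ↦ Y' t ω)
    (hmean : ∀ t, ∫ ω, Y t ω ∂P = ∫ ω, Y' t ω ∂P')
    (hcov : ∀ s t, cov[Y s, Y t; P] = cov[Y' s, Y' t; P']) :
    P.map (fun ω t ↦ Y t ω) = P'.map (fun ω t ↦ Y' t ω) := by
  have := hY.isProbabilityMeasure
  have := hY'.isProbabilityMeasure
  have hL2 (t : T) : MemLp (Y t) 2 P := (hY.hasGaussianLaw_eval t).memLp_two
  have hL2' (t : T) : MemLp (Y' t) 2 P' := (hY'.hasGaussianLaw_eval t).memLp_two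
  have hfin (I : Finset T) :
      P.map (fun ω ↦ I.restrict (Y · ω)) = P'.map (fun ω ↦ I.restrict (Y' · ω)) := by
    have hI := hY.hasGaussianLaw I
    have hI' := hY'.hasGaussianLaw I
    have := hI.isGaussian_map
    have := hI'.isGaussian_map
    classical
    -- The characteristic function of a Gaussian law at `L` involves only the mean and variance of
    -- `L`, and these expand into the means and covariances of the coordinates.
    refine Measure.ext_of_charFunDual (funext fun L ↦ ?_)
    obtain ⟨c, hL⟩ : ∃ c : I → ℝ, ∀ v, L v = ∑ i, c i * v i := by
      refine ⟨fun i ↦ L (Pi.single i 1), fun v ↦ ?_⟩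
      conv_lhs => rw [← Finset.univ_sum_single v, map_sum]
      refine Finset.sum_congr rfl fun i _ ↦ ?_
      have : Pi.single i (v i) = v i • (Pi.single i 1 : I → ℝ) := by
        rw [← Pi.single_smul, smul_eq_mul, mul_one]
      rw [this, map_smul, smul_eq_mul, mul_comm]
    rw [hI.charFunDual_map_eq_fun, hI'.charFunDual_map_eq_fun]
    simp only [hL, Finset.restrict]
    rw [variance_sum_const_mul c fun i : I ↦ hL2 i, variance_sum_const_mul c fun i : I ↦ hL2' i,
      integral_finsetSum _ (fun (i : I) _ ↦ ((hL2 i).integrable (by simp)).const_mul _),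
      integral_finsetSum _ (fun (i : I) _ ↦ ((hL2' i).integrable (by simp)).const_mul _)]
    simp only [integral_const_mul, hmean, hcov]
  have (I : Finset T) : IsFiniteMeasure (P'.map (fun ω ↦ I.restrict (Y' · ω))) :=
    Measure.isFiniteMeasure_map P' _
  have h := isProjectiveLimit_map (X := Y) (P := P) mY.aemeasurable
  simp_rw [hfin] at h
  exact h.unique (isProjectiveLimit_map (X := Y') (P := P') mY'.aemeasurable)

/-- A Gaussian vector with uncorrelated coordinates has a product law. -/
lemma map_eq_pi_gaussianReal {ι : Type*} [Fintype ι] [DecidableEq ι] {P : Measure Ω}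
    {Z : ι → Ω → ℝ} (hZ : HasGaussianLaw (fun ω ↦ (Z · ω)) P) {a d : ι → ℝ}
    (hmean : ∀ i, ∫ ω, Z i ω ∂P = a i)
    (hcov : ∀ i j, cov[Z i, Z j; P] = Matrix.diagonal d i j) :
    P.map (fun ω ↦ (Z · ω)) = Measure.pi fun i ↦ gaussianReal (a i) (d i).toNNReal := by
  have := hZ.isProbabilityMeasure
  have hae (i : ι) : AEMeasurable (Z i) P := (hZ.eval i).aemeasurable
  have hind : iIndepFun Z P := hZ.iIndepFun_of_covariance_eq_zero fun i j hij ↦ by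
    rw [hcov, Matrix.diagonal_apply_ne _ hij]
  rw [(iIndepFun_iff_map_fun_eq_pi_map hae).1 hind]
  congr 1
  ext1 i
  rw [(hZ.eval i).map_eq_gaussianReal, hmean, ← covariance_self (hae i), hcov,
    Matrix.diagonal_apply_eq]

/-- A variable of zero variance is almost surely constant. -/
lemma covariance_eq_zero_of_variance_right {P : Measure Ω} [IsProbabilityMeasure P]
    {Y Z : Ω → ℝ} (hZ : MemLp Z 2 P) (h : cov[Z, Z; P] = 0) : cov[Y, Z; P] = 0 := by
  rw [covariance_self hZ.aemeasurable] at h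
  refine integral_eq_zero_of_ae ?_
  filter_upwards [ae_eq_integral_of_variance_eq_zero hZ h] with ω hω
  simp [hω]

end GaussianProcess

/-! ### Regression residuals and conditional laws -/

section Law

variable {X : Type*} {N : ℕ}

@[fun_prop]
lemma measurable_evalAt (x : Fin N → X) : Measurable (evalAt x) :=
  measurable_pi_lambda _ fun i ↦ measurable_pi_apply (x i)

namespace IsGP

variable {m m' : X → ℝ} {K K' : X → X → ℝ} {P Q : Measure (X → ℝ)}

lemma isProbabilityMeasure (hP : IsGP m K P) : IsProbabilityMeasure P :=
  hP.isGaussianProcess.isProbabilityMeasure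

lemma memLp_two (hP : IsGP m K P) (t : X) : MemLp (fun f : X → ℝ ↦ f t) 2 P :=
  (hP.isGaussianProcess.hasGaussianLaw_eval t).memLp_two

lemma integrable (hP : IsGP m K P) (t : X) : Integrable (fun f : X → ℝ ↦ f t) P :=
  (hP.isGaussianProcess.hasGaussianLaw_eval t).integrable

lemma kernel_comm (hP : IsGP m K P) (s t : X) : K s t = K t s := by
  rw [← hP.cov_eq, covariance_comm, hP.cov_eq]

lemma hasGaussianLaw_evalAt (hP : IsGP m K P) (x : Fin N → X) : HasGaussianLaw (evalAt x) P := by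
  classical
  -- The inputs may repeat, so the vector is a linear image of the values on the finite set of
  -- distinct inputs.
  let L : ((Finset.univ.image x) → ℝ) →L[ℝ] (Fin N → ℝ) :=
    ContinuousLinearMap.pi fun i ↦ ContinuousLinearMap.proj ⟨x i, by simp⟩
  exact (hP.isGaussianProcess.hasGaussianLaw (Finset.univ.image x)).map L

variable (x : Fin N → X)

lemma memLp_dotProduct (hP : IsGP m K P) (a : Fin N → ℝ) :
    MemLp (fun f ↦ a ⬝ᵥ evalAt x f) 2 P :=
  memLp_finsetSum _ fun i _ ↦ (hP.memLp_two (x i)).const_mul (a i)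

lemma integral_dotProduct (hP : IsGP m K P) (a : Fin N → ℝ) :
    ∫ f, a ⬝ᵥ evalAt x f ∂P = a ⬝ᵥ evalAt x m := by
  simp only [dotProduct, evalAt]
  rw [integral_finsetSum _ fun i _ ↦ (hP.integrable (x i)).const_mul (a i)]
  simp [integral_const_mul, hP.mean_eq]

lemma covariance_dotProduct_eval (hP : IsGP m K P) (a : Fin N → ℝ) (t : X) :
    cov[fun f ↦ a ⬝ᵥ evalAt x f, fun f ↦ f t; P] = a ⬝ᵥ kVec K x t := by
  have := hP.isProbabilityMeasure
  simp only [dotProduct, evalAt]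
  rw [covariance_fun_sum_left (fun i ↦ (hP.memLp_two (x i)).const_mul (a i)) (hP.memLp_two t)]
  simp [covariance_const_mul_left, hP.cov_eq, kVec, hP.kernel_comm t]

lemma covariance_dotProduct (hP : IsGP m K P) (a b : Fin N → ℝ) :
    cov[fun f ↦ a ⬝ᵥ evalAt x f, fun f ↦ b ⬝ᵥ evalAt x f; P] = a ⬝ᵥ (gram K x *ᵥ b) := by
  have := hP.isProbabilityMeasure
  simp only [dotProduct, evalAt, Matrix.mulVec]
  rw [covariance_fun_sum_fun_sum (fun i ↦ (hP.memLp_two (x i)).const_mul (a i))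
    (fun i ↦ (hP.memLp_two (x i)).const_mul (b i))]
  simp only [covariance_const_mul_left, covariance_const_mul_right, hP.cov_eq, gram,
    Matrix.of_apply, Finset.mul_sum]
  exact Finset.sum_congr rfl fun i _ ↦ Finset.sum_congr rfl fun j _ ↦ by ring

/-- The quadratic form of `K_NN` at `a` is the variance of `a·f_N`, so `K_NN` is positive
semidefinite and the spectral theorem applies. -/
lemma exists_gram_eq (hP : IsGP m K P) :
    ∃ (U : Matrix (Fin N) (Fin N) ℝ) (d : Fin N → ℝ), U * Uᵀ = 1 ∧ Uᵀ * U = 1 ∧ (∀ i, 0 ≤ d i) ∧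
      gram K x = U * Matrix.diagonal d * Uᵀ := by
  have := hP.isProbabilityMeasure
  have hG : (gram K x).PosSemidef := by
    refine .of_dotProduct_mulVec_nonneg (Matrix.IsHermitian.ext fun i j ↦ ?_) fun a ↦ ?_
    · simp [gram, hP.kernel_comm (x j)]
    · rw [star_trivial, ← hP.covariance_dotProduct,
        covariance_self (hP.memLp_dotProduct x a).aemeasurable]
      exact variance_nonneg _ _
  have hs := hG.1.spectral_theorem
  refine ⟨hG.1.eigenvectorUnitary, hG.1.eigenvalues, ?_, ?_, hG.eigenvalues_nonneg, ?_⟩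
  · simpa [Matrix.star_eq_conjTranspose] using Unitary.coe_mul_star_self hG.1.eigenvectorUnitary
  · simpa [Matrix.star_eq_conjTranspose] using Unitary.coe_star_mul_self hG.1.eigenvectorUnitary
  · simpa [Unitary.conjStarAlgAut_apply, Matrix.star_eq_conjTranspose, Function.comp_def] using hs

/-- The covariances with the values at the inputs lie in the range of the kernel matrix. -/
lemma exists_kVec_eq (hP : IsGP m K P) :
    ∃ A : X → Fin N → ℝ, ∀ t, kVec K x t = gram K x *ᵥ A t := by
  have := hP.isProbabilityMeasure
  obtain ⟨U, d, hU, hU', -, hG⟩ := hP.exists_gram_eq x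
  -- This is the pseudo-inverse of `K_NN` applied to `k_N(t)`: division by a zero eigenvalue yields
  -- `0`.
  refine ⟨fun t ↦ U *ᵥ fun i ↦ (Uᵀ *ᵥ kVec K x t) i / d i, fun t ↦ ?_⟩
  have hd (i : Fin N) : d i * ((Uᵀ *ᵥ kVec K x t) i / d i) = (Uᵀ *ᵥ kVec K x t) i := by
    rcases eq_or_ne (d i) 0 with h | h
    -- For a zero eigenvalue the eigenvector combination of `f_N` has variance zero, so its
    -- covariance with `f(t)`, the `i`-th coordinate of `Uᵀ k_N(t)`, vanishes.
    · have hvar : cov[fun f ↦ Uᵀ i ⬝ᵥ evalAt x f, fun f ↦ Uᵀ i ⬝ᵥ evalAt x f; P] = 0 := by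
        have hD : Uᵀ * gram K x * U = Matrix.diagonal d := by
          rw [hG, ← mul_assoc, ← mul_assoc, hU', one_mul, mul_assoc, hU', mul_one]
        have hi : (Uᵀ * gram K x * U) i i = 0 := by rw [hD, Matrix.diagonal_apply_eq, h]
        rw [hP.covariance_dotProduct, ← hi, mul_assoc, Matrix.mul_apply_eq_vecMul,
          ← Matrix.mul_apply_eq_vecMul]
        rfl
      have hz := covariance_eq_zero_of_variance_right (Y := fun f : X → ℝ ↦ f t)
        (hP.memLp_dotProduct x _) hvar
      rw [covariance_comm, hP.covariance_dotProduct_eval] at hz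
      rw [h, zero_mul]
      exact hz.symm
    · field_simp
  rw [hG, Matrix.mulVec_mulVec, mul_assoc, hU', mul_one, ← Matrix.mulVec_mulVec]
  have : Matrix.diagonal d *ᵥ (fun i ↦ (Uᵀ *ᵥ kVec K x t) i / d i) = Uᵀ *ᵥ kVec K x t := by
    ext i
    rw [Matrix.mulVec_diagonal, hd]
  rw [this, Matrix.mulVec_mulVec, hU, Matrix.one_mulVec]

end IsGP

/-- The residual of `f` after the linear regression with coefficients `A` on its values at the
inputs. -/
def residual (x : Fin N → X) (A : X → Fin N → ℝ) (f : X → ℝ) (t : X) : ℝ :=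
  f t - A t ⬝ᵥ evalAt x f

@[fun_prop]
lemma measurable_residual (x : Fin N → X) (A : X → Fin N → ℝ) : Measurable (residual x A) := by
  unfold residual dotProduct evalAt
  fun_prop

/-- The conditional law given the values `a` at the inputs, when the residual is independent of
them and has law `ρ`. -/
def shiftKernel (A : X → Fin N → ℝ) (ρ : Measure (X → ℝ)) : Kernel (Fin N → ℝ) (X → ℝ) :=
  (Kernel.id ×ₖ Kernel.const _ ρ).map fun p t ↦ p.2 t + A t ⬝ᵥ p.1

lemma measurable_shift (A : X → Fin N → ℝ) :
    Measurable fun (p : (Fin N → ℝ) × (X → ℝ)) t ↦ p.2 t + A t ⬝ᵥ p.1 := by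
  unfold dotProduct
  fun_prop

instance (A : X → Fin N → ℝ) (ρ : Measure (X → ℝ)) [IsProbabilityMeasure ρ] :
    IsMarkovKernel (shiftKernel A ρ) :=
  Kernel.IsMarkovKernel.map _ (measurable_shift A)

lemma shiftKernel_apply (A : X → Fin N → ℝ) (ρ : Measure (X → ℝ)) [IsProbabilityMeasure ρ]
    (a : Fin N → ℝ) : shiftKernel A ρ a = ρ.map fun r t ↦ r t + A t ⬝ᵥ a := by
  rw [shiftKernel, Kernel.map_apply _ (measurable_shift A), Kernel.prod_apply, Kernel.id_apply,
    Kernel.const_apply, Measure.dirac_prod, Measure.map_map (measurable_shift A)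
    measurable_prodMk_left]
  rfl

lemma isCondLaw_shiftKernel {x : Fin N → X} {A : X → Fin N → ℝ} {P : Measure (X → ℝ)}
    [IsProbabilityMeasure P] (h : IndepFun (evalAt x) (residual x A) P) :
    IsCondLaw x P (shiftKernel A (P.map (residual x A))) := by
  have := Measure.isProbabilityMeasure_map (μ := P) (measurable_residual x A).aemeasurable
  have := Measure.isProbabilityMeasure_map (μ := P) (measurable_evalAt x).aemeasurable
  refine ⟨inferInstance, ?_⟩
  set ρ := P.map (residual x A) with hρ
  have hΦ : Measurable fun p : (Fin N → ℝ) × (X → ℝ) ↦ (p.1, fun t ↦ p.2 t + A t ⬝ᵥ p.1) :=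
    measurable_fst.prodMk (measurable_shift A)
  have hmap : P.map (fun f ↦ (evalAt x f, f)) = ((P.map (evalAt x)).prod ρ).map
      fun p ↦ (p.1, fun t ↦ p.2 t + A t ⬝ᵥ p.1) := by
    rw [hρ, ← h.map_prod_eq_prod_map_map (measurable_evalAt x).aemeasurable
      (measurable_residual x A).aemeasurable, Measure.map_map hΦ (by fun_prop)]
    congr 1
    ext1 f
    simp [residual]
  rw [hmap]
  ext s hs
  rw [Measure.map_apply hΦ hs, Measure.prod_apply (hΦ hs), Measure.compProd_apply hs]
  refine lintegral_congr fun a ↦ ?_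
  have ha : Measurable fun (r : X → ℝ) t ↦ r t + A t ⬝ᵥ a := by fun_prop
  rw [shiftKernel_apply, Measure.map_apply ha (measurable_prodMk_left hs)]
  rfl

namespace IsGP

variable {m m' : X → ℝ} {K K' : X → X → ℝ} {P Q : Measure (X → ℝ)} {x : Fin N → X}
  {A : X → Fin N → ℝ}

/-- Joint Gaussianity of `f_N` and the residual is what turns vanishing covariance into
independence. -/
lemma isGaussianProcess_sumElim (hP : IsGP m K P) (x : Fin N → X) (A : X → Fin N → ℝ) :
    IsGaussianProcess (Sum.elim (fun i f ↦ evalAt x f i) fun t f ↦ residual x A f t) P := by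
  classical
  refine hP.isGaussianProcess.of_isGaussianProcess fun s ↦ ?_
  rcases s with i | t
  · exact ⟨{x i}, ContinuousLinearMap.proj ⟨x i, by simp⟩, fun f ↦ rfl⟩
  · refine ⟨insert t (Finset.univ.image x), ContinuousLinearMap.proj ⟨t, by simp⟩
      - ∑ j, A t j • ContinuousLinearMap.proj ⟨x j, by simp⟩, fun f ↦ ?_⟩
    simp [residual, dotProduct, evalAt]

lemma isGaussianProcess_residual (hP : IsGP m K P) (x : Fin N → X) (A : X → Fin N → ℝ) :
    IsGaussianProcess (fun t f ↦ residual x A f t) P :=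
  (hP.isGaussianProcess_sumElim x A).comp_right Sum.inr

lemma integral_residual (hP : IsGP m K P) (x : Fin N → X) (A : X → Fin N → ℝ) (t : X) :
    ∫ f, residual x A f t ∂P = residual x A m t := by
  have := hP.isProbabilityMeasure
  unfold residual
  rw [integral_sub (hP.integrable t) ((hP.memLp_dotProduct x (A t)).integrable (by simp)),
    hP.mean_eq, hP.integral_dotProduct]

lemma covariance_eval_residual (hP : IsGP m K P) (x : Fin N → X) (A : X → Fin N → ℝ) (s t : X) :
    cov[fun f ↦ f s, fun f ↦ residual x A f t; P] = K s t - A t ⬝ᵥ kVec K x s := by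
  have := hP.isProbabilityMeasure
  unfold residual
  rw [covariance_fun_sub_right (hP.memLp_two s) (hP.memLp_two t) (hP.memLp_dotProduct x (A t)),
    hP.cov_eq, covariance_comm, hP.covariance_dotProduct_eval]

lemma covariance_evalAt_residual (hP : IsGP m K P)
    (hA : ∀ t, kVec K x t = gram K x *ᵥ A t) (i : Fin N) (t : X) :
    cov[fun f ↦ evalAt x f i, fun f ↦ residual x A f t; P] = 0 := by
  have h := hP.covariance_eval_residual x A (x i) t
  have hi : K t (x i) = kVec K x (x i) ⬝ᵥ A t := congrFun (hA t) i
  rw [hP.kernel_comm, hi, dotProduct_comm, sub_self] at h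
  exact h

lemma covariance_residual (hP : IsGP m K P) (hA : ∀ t, kVec K x t = gram K x *ᵥ A t) (s t : X) :
    cov[fun f ↦ residual x A f s, fun f ↦ residual x A f t; P] = K s t - A t ⬝ᵥ kVec K x s := by
  have := hP.isProbabilityMeasure
  have hR : MemLp (fun f ↦ residual x A f t) 2 P :=
    ((hP.isGaussianProcess_residual x A).hasGaussianLaw_eval t).memLp_two
  conv_lhs => enter [1]; unfold residual
  rw [covariance_fun_sub_left (hP.memLp_two s) (hP.memLp_dotProduct x (A s)) hR,
    hP.covariance_eval_residual]
  have hz : cov[fun f ↦ A s ⬝ᵥ evalAt x f, fun f ↦ residual x A f t; P] = 0 := by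
    simp only [dotProduct]
    rw [covariance_fun_sum_left (X := fun i (f : X → ℝ) ↦ A s i * evalAt x f i)
      (fun i ↦ (hP.memLp_two (x i)).const_mul (A s i)) hR]
    exact Finset.sum_eq_zero fun i _ ↦ by
      rw [covariance_const_mul_left, hP.covariance_evalAt_residual hA, mul_zero]
  rw [hz, sub_zero]

lemma indepFun_residual (hP : IsGP m K P) (hA : ∀ t, kVec K x t = gram K x *ᵥ A t) :
    IndepFun (evalAt x) (residual x A) P :=
  (hP.isGaussianProcess_sumElim x A).indepFun_of_covariance_eq_zero
    (fun i ↦ (measurable_pi_apply (x i)).aemeasurable)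
    (fun t ↦ ((measurable_pi_apply t).comp (measurable_residual x A)).aemeasurable)
    (hP.covariance_evalAt_residual hA)

lemma map_residual_eq (hP : IsGP m K P) (hQ : IsGP m' K' Q)
    (hA : ∀ t, kVec K x t = gram K x *ᵥ A t) (hA' : ∀ t, kVec K' x t = gram K' x *ᵥ A t)
    (hm : residual x A m = residual x A m')
    (hK : ∀ s t, K s t - A t ⬝ᵥ kVec K x s = K' s t - A t ⬝ᵥ kVec K' x s) :
    P.map (residual x A) = Q.map (residual x A) :=
  map_eq_of_isGaussianProcess (hP.isGaussianProcess_residual x A)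
    (hQ.isGaussianProcess_residual x A) (measurable_residual x A) (measurable_residual x A)
    (fun t ↦ by rw [hP.integral_residual, hQ.integral_residual, hm])
    (fun s t ↦ by rw [hP.covariance_residual hA, hQ.covariance_residual hA', hK])

end IsGP

lemma isCondLaw_iff_of_absolutelyContinuous {x : Fin N → X} {P Q : Measure (X → ℝ)}
    [IsProbabilityMeasure P] [IsProbabilityMeasure Q] {κ₀ : Kernel (Fin N → ℝ) (X → ℝ)}
    (hP : IsCondLaw x P κ₀) (hQ : IsCondLaw x Q κ₀)
    (hPQ : P.map (evalAt x) ≪ Q.map (evalAt x)) (hQP : Q.map (evalAt x) ≪ P.map (evalAt x))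
    (κ : Kernel (Fin N → ℝ) (X → ℝ)) : IsCondLaw x Q κ ↔ IsCondLaw x P κ := by
  have := hP.isMarkovKernel
  refine ⟨fun h ↦ ⟨h.isMarkovKernel, ?_⟩, fun h ↦ ⟨h.isMarkovKernel, ?_⟩⟩ <;>
  have := h.isMarkovKernel
  · rw [← hP.compProd_eq]
    exact compProd_eq_of_absolutelyContinuous hPQ (h.compProd_eq.trans hQ.compProd_eq.symm)
  · rw [← hQ.compProd_eq]
    exact compProd_eq_of_absolutelyContinuous hQP (h.compProd_eq.trans hP.compProd_eq.symm)

lemma klDiv_map_evalAt_prod (x : Fin N → X) (P Q : Measure (X → ℝ)) [IsProbabilityMeasure P]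
    [IsProbabilityMeasure Q] :
    klDiv (Q.map fun f ↦ (evalAt x f, f)) (P.map fun f ↦ (evalAt x f, f)) = klDiv Q P :=
  klDiv_map_of_leftInverse Q P (by fun_prop) measurable_snd fun _ ↦ rfl

end Law

/-! ### Comparison of prior and posterior -/

section Posterior

variable {X : Type*} {N : ℕ} {m : X → ℝ} {K : X → X → ℝ} {P Q : Measure (X → ℝ)}

lemma evalAt_posteriorMean (m : X → ℝ) (K : X → X → ℝ) (x : Fin N → X) (y : Fin N → ℝ) (σ : ℝ) :
    evalAt x (posteriorMean m K x y σ)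
      = evalAt x m + gram K x *ᵥ ((noisyGram K x σ)⁻¹ *ᵥ (y - evalAt x m)) := rfl

lemma gram_transpose {x : Fin N → X} (hK : ∀ s t, K s t = K t s) :
    (gram K x)ᵀ = gram K x := by
  ext i j
  exact hK _ _

/-- The posterior shifts the mean at `t` by `k_N(t)·w = A(t)·K_NN w`, where `K_NN w` is the shift at
the inputs: the regression subtracts exactly this. -/
lemma residual_posteriorMean {x : Fin N → X} {A : X → Fin N → ℝ}
    (hK : ∀ s t, K s t = K t s) (hA : ∀ t, kVec K x t = gram K x *ᵥ A t) (y : Fin N → ℝ)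
    (σ : ℝ) : residual x A (posteriorMean m K x y σ) = residual x A m := by
  ext t
  rw [residual, evalAt_posteriorMean, posteriorMean, residual, dotProduct_add,
    Matrix.dotProduct_mulVec (A t), ← Matrix.mulVec_transpose, gram_transpose hK, ← hA]
  ring

/-- The transpose of the inverse appears because symmetry of `K` is not assumed here. -/
lemma kVec_posteriorKernel {x : Fin N → X} (σ : ℝ) (t : X) :
    kVec (posteriorKernel K x σ) x t
      = kVec K x t - gram K x *ᵥ ((noisyGram K x σ)⁻¹ᵀ *ᵥ kVec K x t) := by
  ext j
  simp only [kVec, posteriorKernel, Pi.sub_apply]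
  congr 1
  rw [Matrix.dotProduct_mulVec, ← Matrix.mulVec_transpose, dotProduct_comm]
  rfl

lemma gram_posteriorKernel {x : Fin N → X} (hK : ∀ s t, K s t = K t s) (σ : ℝ) :
    gram (posteriorKernel K x σ) x
      = gram K x - gram K x * (noisyGram K x σ)⁻¹ * gram K x := by
  ext i j
  rw [Matrix.sub_apply, mul_assoc, Matrix.mul_apply]
  simp only [gram, Matrix.of_apply, posteriorKernel]
  congr 1
  refine Finset.sum_congr rfl fun k _ ↦ ?_
  rw [Matrix.mul_apply]
  simp only [Matrix.mulVec, dotProduct, kVec, Matrix.of_apply, hK (x j)]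

lemma noisyGram_transpose {x : Fin N → X} (hK : ∀ s t, K s t = K t s) (σ : ℝ) :
    (noisyGram K x σ)ᵀ = noisyGram K x σ := by
  simp [noisyGram, gram_transpose hK]

/-- The same coefficients `A` decorrelate the residual from `f_N` under the posterior. -/
lemma kVec_posteriorKernel_eq {x : Fin N → X} {A : X → Fin N → ℝ}
    (hK : ∀ s t, K s t = K t s) (hA : ∀ t, kVec K x t = gram K x *ᵥ A t) (σ : ℝ) (t : X) :
    kVec (posteriorKernel K x σ) x t = gram (posteriorKernel K x σ) x *ᵥ A t := by
  rw [kVec_posteriorKernel, gram_posteriorKernel hK, Matrix.transpose_nonsing_inv,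
    noisyGram_transpose hK, hA, Matrix.sub_mulVec, Matrix.mulVec_mulVec, Matrix.mulVec_mulVec,
    mul_assoc]

lemma posteriorKernel_sub_dotProduct {x : Fin N → X} {A : X → Fin N → ℝ}
    (hK : ∀ s t, K s t = K t s) (hA : ∀ t, kVec K x t = gram K x *ᵥ A t) (σ : ℝ) (s t : X) :
    posteriorKernel K x σ s t - A t ⬝ᵥ kVec (posteriorKernel K x σ) x s
      = K s t - A t ⬝ᵥ kVec K x s := by
  rw [kVec_posteriorKernel, dotProduct_sub, posteriorKernel,
    Matrix.dotProduct_mulVec (A t), ← Matrix.mulVec_transpose, gram_transpose hK, ← hA, Matrix.dotProduct_mulVec,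
    ← Matrix.mulVec_transpose, dotProduct_comm (kVec K x t)]
  ring

/-- The prior and the posterior have a common conditional law given the values at the inputs. -/
lemma exists_isCondLaw_both {x : Fin N → X} {y : Fin N → ℝ} {σ : ℝ} (hP : IsGP m K P)
    (hQ : IsGP (posteriorMean m K x y σ) (posteriorKernel K x σ) Q) :
    ∃ κ, IsCondLaw x P κ ∧ IsCondLaw x Q κ := by
  have := hP.isProbabilityMeasure
  have := hQ.isProbabilityMeasure
  obtain ⟨A, hA⟩ := hP.exists_kVec_eq x
  have hA' := kVec_posteriorKernel_eq hP.kernel_comm hA σ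
  refine ⟨_, isCondLaw_shiftKernel (hP.indepFun_residual hA), ?_⟩
  rw [hP.map_residual_eq hQ hA hA' (residual_posteriorMean hP.kernel_comm hA y σ).symm
    fun s t ↦ (posteriorKernel_sub_dotProduct hP.kernel_comm hA σ s t).symm]
  exact isCondLaw_shiftKernel (hQ.indepFun_residual hA')

lemma IsGP.map_coordinates (hP : IsGP m K P) {x : Fin N → X} {U : Matrix (Fin N) (Fin N) ℝ}
    {d : Fin N → ℝ} (hU : Uᵀ * gram K x * U = Matrix.diagonal d) (c : Fin N → ℝ) :
    P.map (fun f ↦ Uᵀ *ᵥ (evalAt x f - c))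
      = Measure.pi fun i ↦ gaussianReal ((Uᵀ *ᵥ (evalAt x m - c)) i) (d i).toNNReal := by
  have := hP.isProbabilityMeasure
  have hlin := ((hP.hasGaussianLaw_evalAt x).map_fun
    (LinearMap.toContinuousLinearMap (Matrix.mulVecLin Uᵀ))).isGaussian_map
  have hint (i : Fin N) : Integrable (fun f ↦ Uᵀ i ⬝ᵥ evalAt x f) P :=
    (hP.memLp_dotProduct x _).integrable (by simp)
  have hsub : (fun f ↦ Uᵀ *ᵥ (evalAt x f - c))
      = fun f : X → ℝ ↦ fun i ↦ Uᵀ i ⬝ᵥ evalAt x f - Uᵀ i ⬝ᵥ c := by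
    ext f i
    exact dotProduct_sub _ _ _
  have hm : Measurable fun f ↦ Uᵀ *ᵥ evalAt x f :=
    (Continuous.matrix_mulVec continuous_const continuous_id).measurable.comp (measurable_evalAt x)
  rw [hsub]
  refine map_eq_pi_gaussianReal ⟨?_⟩ (fun i ↦ ?_) fun i j ↦ ?_
  · have : IsGaussian ((P.map fun f ↦ Uᵀ *ᵥ evalAt x f).map fun v ↦ v - Uᵀ *ᵥ c) := by
      have : IsGaussian (P.map fun f ↦ Uᵀ *ᵥ evalAt x f) := hlin
      infer_instance
    rwa [Measure.map_map (by fun_prop) hm] at this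
  · rw [integral_sub (hint i) (integrable_const _), hP.integral_dotProduct]
    simp only [integral_const, probReal_univ, one_smul]
    exact (dotProduct_sub _ _ _).symm
  · rw [covariance_sub_const_left (hint i), covariance_sub_const_right (hint j),
      hP.covariance_dotProduct, ← hU, mul_assoc]
    rfl

end Posterior

/-! ### Calculus of simultaneously diagonalized matrices -/

section Spectral

variable {N : ℕ} {U : Matrix (Fin N) (Fin N) ℝ}

lemma conj_diagonal_mul (hU : Uᵀ * U = 1) (a b : Fin N → ℝ) :
    U * Matrix.diagonal a * Uᵀ * (U * Matrix.diagonal b * Uᵀ)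
      = U * Matrix.diagonal (fun i ↦ a i * b i) * Uᵀ := by
  rw [← Matrix.diagonal_mul_diagonal, mul_assoc (U * Matrix.diagonal a), ← mul_assoc Uᵀ,
    ← mul_assoc Uᵀ, hU, one_mul]
  simp only [mul_assoc]

lemma trace_conj_diagonal (hU : Uᵀ * U = 1) (a : Fin N → ℝ) :
    (U * Matrix.diagonal a * Uᵀ).trace = ∑ i, a i := by
  rw [Matrix.trace_mul_comm, ← mul_assoc, hU, one_mul, Matrix.trace_diagonal]

lemma det_conj_diagonal (hU : Uᵀ * U = 1) (a : Fin N → ℝ) :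
    (U * Matrix.diagonal a * Uᵀ).det = ∏ i, a i := by
  rw [Matrix.det_mul_comm, ← mul_assoc, hU, one_mul, Matrix.det_diagonal]

lemma dotProduct_conj_diagonal_mulVec (a v : Fin N → ℝ) :
    v ⬝ᵥ ((U * Matrix.diagonal a * Uᵀ) *ᵥ v) = ∑ i, a i * (Uᵀ *ᵥ v) i ^ 2 := by
  rw [← Matrix.mulVec_mulVec, ← Matrix.mulVec_mulVec, Matrix.dotProduct_mulVec,
    ← Matrix.mulVec_transpose]
  simp only [dotProduct, Matrix.mulVec_diagonal]
  exact Finset.sum_congr rfl fun i _ ↦ by ring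

end Spectral

/-! ### The divergence between the laws of the values at the inputs -/

section Formula

variable {X : Type*} {N : ℕ} {m : X → ℝ} {K : X → X → ℝ} {P Q : Measure (X → ℝ)}

lemma klDiv_map_evalAt_posterior {x : Fin N → X} {y : Fin N → ℝ} {σ : ℝ} (hσ : 0 < σ)
    (hP : IsGP m K P) (hQ : IsGP (posteriorMean m K x y σ) (posteriorKernel K x σ) Q) :
    P.map (evalAt x) ≪ Q.map (evalAt x) ∧ Q.map (evalAt x) ≪ P.map (evalAt x) ∧
    klDiv (Q.map (evalAt x)) (P.map (evalAt x)) ≠ ∞ ∧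
    (klDiv (Q.map (evalAt x)) (P.map (evalAt x))).toReal =
      1 / 2 * Real.log (noisyGram K x σ).det
        - (N : ℝ) / 2 * Real.log (σ ^ 2)
        - 1 / 2 * (gram K x * (noisyGram K x σ)⁻¹).trace
        + 1 / 2 * ((y - evalAt x m) ⬝ᵥ
            (((noisyGram K x σ)⁻¹ * gram K x * (noisyGram K x σ)⁻¹) *ᵥ (y - evalAt x m))) := by
  have := hP.isProbabilityMeasure
  have := hQ.isProbabilityMeasure
  have := Measure.isProbabilityMeasure_map (μ := P) (measurable_evalAt x).aemeasurable
  have := Measure.isProbabilityMeasure_map (μ := Q) (measurable_evalAt x).aemeasurable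
  obtain ⟨U, d, hU, hU', hd, hG⟩ := hP.exists_gram_eq x
  have hr : 0 < σ ^ 2 := by positivity
  have hdr (i : Fin N) : d i + σ ^ 2 ≠ 0 := (add_pos_of_nonneg_of_pos (hd i) hr).ne'
  have hC : noisyGram K x σ = U * Matrix.diagonal (fun i ↦ d i + σ ^ 2) * Uᵀ := by
    rw [noisyGram, hG, ← Matrix.diagonal_add, mul_add, add_mul, ← Matrix.smul_one_eq_diagonal,
      Matrix.mul_smul, mul_one, Matrix.smul_mul, hU]
  have hCinv : (noisyGram K x σ)⁻¹ = U * Matrix.diagonal (fun i ↦ (d i + σ ^ 2)⁻¹) * Uᵀ := by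
    refine Matrix.inv_eq_right_inv ?_
    rw [hC, conj_diagonal_mul hU']
    simp [hdr, hU]
  have hconj (a : Fin N → ℝ) : Uᵀ * (U * Matrix.diagonal a * Uᵀ) * U = Matrix.diagonal a := by
    rw [← mul_assoc, ← mul_assoc, hU', one_mul, mul_assoc, hU', mul_one]
  set z : Fin N → ℝ := Uᵀ *ᵥ (y - evalAt x m) with hz
  have hPc : P.map (fun f ↦ Uᵀ *ᵥ (evalAt x f - evalAt x m))
      = Measure.pi fun i ↦ gaussianReal 0 (d i).toNNReal := by
    rw [hP.map_coordinates (by rw [hG, hconj])]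
    simp
  -- In the eigenbasis the posterior is scalar regression with prior variance `d i`, noise variance
  -- `σ ^ 2` and observation `z i`; indeed `d - d² / (d + σ²) = d σ² / (d + σ²)`.
  have hQc : Q.map (fun f ↦ Uᵀ *ᵥ (evalAt x f - evalAt x m)) = Measure.pi fun i ↦
      gaussianReal (d i * z i / (d i + σ ^ 2)) (d i * σ ^ 2 / (d i + σ ^ 2)).toNNReal := by
    have hcov : gram (posteriorKernel K x σ) x
        = U * Matrix.diagonal (fun i ↦ d i * σ ^ 2 / (d i + σ ^ 2)) * Uᵀ := by
      rw [gram_posteriorKernel hP.kernel_comm, hCinv, hG, conj_diagonal_mul hU',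
        conj_diagonal_mul hU', ← sub_mul, ← mul_sub, Matrix.diagonal_sub]
      congr 3
      ext i
      have := hdr i
      field_simp
      ring
    rw [hQ.map_coordinates (by rw [hcov, hconj])]
    congr 1
    ext1 i
    congr 1
    rw [evalAt_posteriorMean, add_sub_cancel_left, Matrix.mulVec_mulVec, Matrix.mulVec_mulVec, hG,
      hCinv, mul_assoc, conj_diagonal_mul hU', ← mul_assoc, ← mul_assoc, hU', one_mul,
      ← Matrix.mulVec_mulVec, Matrix.mulVec_diagonal, ← hz]
    ring
  choose g hg hdens hint hval using fun i ↦ exists_logDensity_posterior (hd i) hr (z i)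
  obtain ⟨hQP, hPQ, htop, hkl⟩ := klDiv_pi_withDensity_exp hg hdens hint
  have hφ : Measurable fun a : Fin N → ℝ ↦ Uᵀ *ᵥ (a - evalAt x m) :=
    Continuous.measurable (by fun_prop)
  have hψ : Measurable fun b : Fin N → ℝ ↦ U *ᵥ b + evalAt x m :=
    Continuous.measurable (by fun_prop)
  have hinv : Function.LeftInverse (fun b : Fin N → ℝ ↦ U *ᵥ b + evalAt x m)
      fun a ↦ Uᵀ *ᵥ (a - evalAt x m) := fun a ↦ by
    simp [Matrix.mulVec_mulVec, hU]
  -- The change of coordinates is undone by `U *ᵥ b + m_N`, so absolute continuity of the product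
  -- laws passes back to the laws of `f_N`.
  have hmap (R : Measure (X → ℝ)) : R.map (evalAt x)
      = (R.map fun f ↦ Uᵀ *ᵥ (evalAt x f - evalAt x m)).map fun b ↦ U *ᵥ b + evalAt x m := by
    have hφx : Measurable fun f : X → ℝ ↦ Uᵀ *ᵥ (evalAt x f - evalAt x m) :=
      hφ.comp (measurable_evalAt x)
    rw [Measure.map_map hψ hφx]
    congr 1
    ext1 f
    exact (hinv (evalAt x f)).symm
  have hkl' := klDiv_map_of_leftInverse (Q.map (evalAt x)) (P.map (evalAt x)) hφ hψ hinv
  rw [Measure.map_map hφ (measurable_evalAt x), Measure.map_map hφ (measurable_evalAt x)] at hkl'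
  refine ⟨?_, ?_, ?_, ?_⟩
  · rw [hmap P, hmap Q, hPc, hQc]
    exact hPQ.map hψ
  · rw [hmap P, hmap Q, hPc, hQc]
    exact hQP.map hψ
  · rw [← hkl']
    simp only [Function.comp_def]
    rwa [hPc, hQc]
  · rw [← hkl']
    simp only [Function.comp_def]
    rw [hPc, hQc, hkl, hCinv, hG, conj_diagonal_mul hU', conj_diagonal_mul hU',
      conj_diagonal_mul hU', dotProduct_conj_diagonal_mulVec, trace_conj_diagonal hU', hC,
      det_conj_diagonal hU', Real.log_prod fun i _ ↦ hdr i]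
    simp only [hval, Finset.sum_add_distrib, Finset.sum_sub_distrib, ← Finset.mul_sum,
      Finset.sum_const, Finset.card_univ, Fintype.card_fin, nsmul_eq_mul, ← hz]
    congr 1
    · simp only [div_eq_mul_inv]
      ring
    · congr 1
      refine Finset.sum_congr rfl fun i _ ↦ ?_
      have := hdr i
      field_simp

end Formula

end GPRegression

end

theorem mainTheorem3 {X : Type*} (m : X → ℝ) (K : X → X → ℝ)
    (N : ℕ) (x : Fin N → X) (y : Fin N → ℝ) (σ : ℝ) (hσ : 0 < σ)
    (P Q : Measure (X → ℝ))
    (hP : GPRegression.IsGP m K P)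
    (hQ : GPRegression.IsGP (GPRegression.posteriorMean m K x y σ)
      (GPRegression.posteriorKernel K x σ) Q) :
    -- the conditional distribution of `f` given `f_N` exists under `P`
    (∃ κ, GPRegression.IsCondLaw x P κ) ∧
    -- `Q(f | f_N) = P(f | f_N)`
    (∀ κ, GPRegression.IsCondLaw x Q κ ↔ GPRegression.IsCondLaw x P κ) ∧
    -- `KL(Q ‖ P) = KL(Q(f_N) Q(f | f_N) ‖ P(f_N) P(f | f_N))`
    (∀ κ_Q κ_P, GPRegression.IsCondLaw x Q κ_Q → GPRegression.IsCondLaw x P κ_P →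
      klDiv Q P = klDiv (Q.map (GPRegression.evalAt x) ⊗ₘ κ_Q)
        (P.map (GPRegression.evalAt x) ⊗ₘ κ_P)) ∧
    -- `KL(Q ‖ P) = KL(Q(f_N) ‖ P(f_N))`
    klDiv Q P = klDiv (Q.map (GPRegression.evalAt x)) (P.map (GPRegression.evalAt x)) ∧
    -- the closed formula (the divergence being finite)
    klDiv Q P ≠ ∞ ∧
    (klDiv Q P).toReal =
      1 / 2 * Real.log (GPRegression.noisyGram K x σ).det
        - (N : ℝ) / 2 * Real.log (σ ^ 2)
        - 1 / 2 * (GPRegression.gram K x * (GPRegression.noisyGram K x σ)⁻¹).trace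
        + 1 / 2 * ((y - GPRegression.evalAt x m) ⬝ᵥ
            (((GPRegression.noisyGram K x σ)⁻¹ * GPRegression.gram K x *
              (GPRegression.noisyGram K x σ)⁻¹) *ᵥ (y - GPRegression.evalAt x m))) := by
  have := hP.isProbabilityMeasure
  have := hQ.isProbabilityMeasure
  have := Measure.isProbabilityMeasure_map (μ := P)
    (GPRegression.measurable_evalAt x).aemeasurable
  have := Measure.isProbabilityMeasure_map (μ := Q)
    (GPRegression.measurable_evalAt x).aemeasurable
  obtain ⟨hPQ, hQP, htop, hkl⟩ := GPRegression.klDiv_map_evalAt_posterior hσ hP hQ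
  obtain ⟨κ, hκP, hκQ⟩ := GPRegression.exists_isCondLaw_both hP hQ
  have := hκP.isMarkovKernel
  have hjoint := GPRegression.klDiv_map_evalAt_prod x P Q
  have heq : klDiv Q P
      = klDiv (Q.map (GPRegression.evalAt x)) (P.map (GPRegression.evalAt x)) := by
    -- Both joint laws are written with the common kernel `κ`, which contributes nothing to the
    -- divergence.
    rw [← hjoint, ← hκQ.compProd_eq, ← hκP.compProd_eq, klDiv_compProd_left]
  refine ⟨⟨κ, hκP⟩,
    GPRegression.isCondLaw_iff_of_absolutelyContinuous hκP hκQ hPQ hQP,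
    fun κ_Q κ_P hκ_Q hκ_P ↦ ?_, heq, heq ▸ htop, heq ▸ hkl⟩
  rw [hκ_Q.compProd_eq, hκ_P.compProd_eq, hjoint]
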